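/- Let $\mathcal H,\mathcal H_1,\dots,\mathcal H_n$ be finite-dimensional complex Hilbert spaces, let $N=\{1,\dots,n\}$, and for $X\subseteq N$ put $\mathcal H_X=\bigotimes_{i\in X}\mathcal H_i$. Let $\mathcal S(\mathcal J)$ be the set of density operators on a Hilbert space $\mathcal J$ and $\mathcal S_1(\mathcal J)$ the set of pure states on $\mathcal J$. A quantum operation is a completely positive and trace preserving map. A linear map $\mathcal E$ sending $\mathcal S(\mathcal J)$ into $\mathcal S(\mathcal K)$ is called reversible if there is a quantum operation $\mathcal R$ from $\mathcal S(\mathcal K)$ to $\mathcal S(\mathcal J)$ with $\mathcal R(\mathcal E(\rho))=\rho$ for all $\rho\in\mathcal S(\mathcal J)$, and vanishing if there is $\rho_0\in\mathcal S(\mathcal K)$ with $\mathcal E(\rho)=\rho_0$ for all $\rho\in\mathcal S(\mathcal J)$. A quantum secret sharing (QSS) scheme is a reversible quantum operation $W_N:\mathcal S(\mathcal H)\to\mathcal S(\mathcal H_N)$. For $X\subseteq N$ let $W_X=\mathrm{Tr}_{N\setminus X}\circ W_N$; the set $X$ is called qualified if $W_X$ is reversible, and forbidden if $W_X$ is vanishing.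 It is called significant if there is a forbidden set $Y\subseteq N$ such that $X\cup Y$ is qualified. Theorem. Let $W_N$ be any QSS scheme and let $X\subseteq N$ be significant. Then for every Borel probability measure $\mu$ on $\mathcal S_1(\mathcal H)$ with full support (that is, $\mu(O)>0$ for every nonempty relatively open set $O\subseteq\mathcal S_1(\mathcal H)$), $$H(\sigma_\mu)\le H(W_X(\sigma_\mu)),$$ where $\sigma_\mu=\int_{\mathcal S_1(\mathcal H)}\rho\,\mu(d\rho)$ and $H(\rho)=-\mathrm{Tr}\,\rho\log\rho$ is the von Neumann entropy. -/

import Mathlib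

open MeasureTheory
open scoped ComplexOrder

/-! Operators on a finite dimensional Hilbert space `ℂ^a` (`a` a finite type indexing an orthonormal
basis) are matrices in `Matrix a a ℂ`. The composite of shares with spaces `ℂ^(b i)`, `i ∈ X`, has
the product basis indexed by the dependent functions `∀ i : {i // i ∈ X}, b i`. -/

/-- The density operators on `ℂ^a`: positive semidefinite matrices of trace one. -/
def densityOperators (a : Type*) [Fintype a] : Set (Matrix a a ℂ) :=
  {ρ | ρ.PosSemidef ∧ ρ.trace = 1}

/-- The pure states on `ℂ^a`: the rank-one projections `|ψ⟩⟨ψ|` with `ψ` a unit vector. -/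
def pureStates (a : Type*) [Fintype a] : Set (Matrix a a ℂ) :=
  {ρ | ∃ ψ : a → ℂ, dotProduct (star ψ) ψ = 1 ∧ ρ = Matrix.vecMulVec ψ (star ψ)}

section QuantumOperation

open scoped CStarAlgebra Matrix.Norms.L2Operator MatrixOrder

/-- A quantum operation: a completely positive and trace preserving linear map. -/
structure QuantumOperation (a b : Type*) [Fintype a] [DecidableEq a] [Fintype b] [DecidableEq b]
    extends Matrix a a ℂ →CP Matrix b b ℂ where
  trace_map' : ∀ A : Matrix a a ℂ, (toLinearMap A).trace = A.trace

/-- The linear map on operators underlying a quantum operation. -/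
def QuantumOperation.lin {a b : Type*} [Fintype a] [DecidableEq a] [Fintype b] [DecidableEq b]
    (E : QuantumOperation a b) : Matrix a a ℂ →ₗ[ℂ] Matrix b b ℂ :=
  E.toLinearMap

end QuantumOperation

/-- `E` is reversible with respect to `S`: some quantum operation undoes `E` on `S`. -/
def IsReversibleOn {a b : Type*} [Fintype a] [DecidableEq a] [Fintype b] [DecidableEq b]
    (E : Matrix a a ℂ →ₗ[ℂ] Matrix b b ℂ) (S : Set (Matrix a a ℂ)) : Prop :=
  ∃ R : QuantumOperation b a, ∀ ρ ∈ S, R.lin (E ρ) = ρ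

/-- `E` is vanishing with respect to `S`: it maps all of `S` to one fixed density operator. -/
def IsVanishingOn {a b : Type*} [Fintype b]
    (E : Matrix a a ℂ →ₗ[ℂ] Matrix b b ℂ) (S : Set (Matrix a a ℂ)) : Prop :=
  ∃ ρ₀ ∈ densityOperators b, ∀ ρ ∈ S, E ρ = ρ₀

/-- The von Neumann entropy `H(ρ) = -Tr (ρ log ρ)`, with natural logarithm and `0 log 0 = 0`. -/
noncomputable def vonNeumannEntropy {a : Type*} [Fintype a] [DecidableEq a]
    (ρ : Matrix a a ℂ) : ℝ :=
  -((ρ * cfc Real.log ρ).trace).re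

/-- The average state `σ_μ = ∫ ρ dμ(ρ)` of an ensemble `μ` on a set `S` of states; the integral of
a matrix-valued function is taken entrywise. -/
noncomputable def averageState {a : Type*} {S : Set (Matrix a a ℂ)} [MeasurableSpace S]
    (μ : Measure S) : Matrix a a ℂ :=
  Matrix.of fun i j => ∫ ρ : S, (ρ : Matrix a a ℂ) i j ∂μ

section Shares

variable {ι : Type*} [Fintype ι] [DecidableEq ι]
  {b : ι → Type*} [∀ i, Fintype (b i)] [∀ i, DecidableEq (b i)]
  {a : Type*} [Fintype a] [DecidableEq a]

/-- The basis index of all shares assembled from an index `x` of the shares in `X` and an index `z`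
of the shares outside `X`. -/
def glueIndex (X : Finset ι) (x : ∀ i : {i // i ∈ X}, b i) (z : ∀ i : {i // i ∉ X}, b i) :
    ∀ i, b i :=
  fun i => if h : i ∈ X then x ⟨i, h⟩ else z ⟨i, h⟩

/-- The partial trace over the complement of `X`. -/
def partialTraceCompl (X : Finset ι) :
    Matrix (∀ i, b i) (∀ i, b i) ℂ →ₗ[ℂ]
      Matrix (∀ i : {i // i ∈ X}, b i) (∀ i : {i // i ∈ X}, b i) ℂ where
  toFun A := Matrix.of fun x y =>
    ∑ z : (∀ i : {i // i ∉ X}, b i), A (glueIndex X x z) (glueIndex X y z)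
  map_add' A B := by
    ext x y
    simp [Finset.sum_add_distrib]
  map_smul' c A := by
    ext x y
    simp [Finset.mul_sum]

/-- `W_X`: the encoder followed by the partial trace over the shares outside `X`. -/
def shareMap (W : QuantumOperation a (∀ i, b i)) (X : Finset ι) :
    Matrix a a ℂ →ₗ[ℂ] Matrix (∀ i : {i // i ∈ X}, b i) (∀ i : {i // i ∈ X}, b i) ℂ :=
  partialTraceCompl X ∘ₗ W.lin

/-- A quantum secret sharing scheme: an encoder that is reversible on all density operators. -/
def IsQSSScheme (W : QuantumOperation a (∀ i, b i)) : Prop :=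
  IsReversibleOn W.lin (densityOperators a)

/-- The set `X` of shares is qualified: the secret can be recovered from it. -/
def IsQualified (W : QuantumOperation a (∀ i, b i)) (X : Finset ι) : Prop :=
  IsReversibleOn (shareMap W X) (densityOperators a)

/-- The set `X` of shares is forbidden: its state does not depend on the secret. -/
def IsForbidden (W : QuantumOperation a (∀ i, b i)) (X : Finset ι) : Prop :=
  IsVanishingOn (shareMap W X) (densityOperators a)

/-- The set `X` of shares is significant: adding some forbidden set makes it qualified. -/
def IsSignificant (W : QuantumOperation a (∀ i, b i)) (X : Finset ι) : Prop :=
  ∃ Y : Finset ι, IsForbidden W Y ∧ IsQualified W (X ∪ Y)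

end Shares

/-! ### Von Neumann entropy: spectral invariance, additivity and subadditivity. -/

section Entropy

open Matrix Polynomial
open scoped Kronecker

variable {m n : Type*} [Fintype m] [DecidableEq m] [Fintype n] [DecidableEq n]

/-! The inequality holds for every density operator `ρ`, and the measure matters only because its
average state is one. Subsets of forbidden sets are forbidden, so the forbidden set `Y` may be
replaced by `Y \ X`. The Kraus operators of the encoder then assemble into an isometry from the
secret to three systems: `x` (the shares in `X`), `y` (those in `Y`) and an environment `e` (the
remaining shares and the Kraus index).

Purify `ρ` by a reference `r`. Since `Y` is forbidden, `y` is uncorrelated with `r`. Since `X ∪ Y`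
is qualified, the Knill–Laflamme condition (`exists_conjTranspose_mul_eq_smul_one`) makes `e`
uncorrelated with `r`. The global state is pure, so additivity and subadditivity give H(r) + H(e) =
H(re) = H(xy) ≤ H(x) + H(y), and likewise H(r) + H(y) ≤ H(x) + H(e). Adding the two cancels H(y) and
H(e) and leaves H(ρ) = H(r) ≤ H(x). -/

lemma Matrix.IsHermitian.exists_diagonalization {A : Matrix n n ℂ} (hA : A.IsHermitian) :
    ∃ U : Matrix n n ℂ, Uᴴ * U = 1 ∧ U * Uᴴ = 1 ∧
      A = U * diagonal (fun i => (hA.eigenvalues i : ℂ)) * Uᴴ ∧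
      ∀ f : ℝ → ℝ, cfc f A = U * diagonal (fun i => (f (hA.eigenvalues i) : ℂ)) * Uᴴ := by
  refine ⟨hA.eigenvectorUnitary, ?_, ?_, ?_, fun f => ?_⟩
  · rw [← star_eq_conjTranspose]; simp
  · rw [← star_eq_conjTranspose]; simp
  · conv_lhs => rw [hA.spectral_theorem, Unitary.conjStarAlgAut_apply]
    rfl
  · rw [hA.cfc_eq, Matrix.IsHermitian.cfc, Unitary.conjStarAlgAut_apply]
    rfl

/-- The von Neumann entropy is the Shannon entropy of the eigenvalues. -/
lemma vonNeumannEntropy_eq_sum_eigenvalues {A : Matrix n n ℂ} (hA : A.IsHermitian) :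
    vonNeumannEntropy A = ∑ i, Real.negMulLog (hA.eigenvalues i) := by
  obtain ⟨U, hU, -, hA', hf⟩ := hA.exists_diagonalization
  have h : A * cfc Real.log A
      = U * diagonal (fun i => ((hA.eigenvalues i * Real.log (hA.eigenvalues i) : ℝ) : ℂ)) * Uᴴ := by
    rw [hf]
    conv_lhs => enter [1]; rw [hA']
    calc _ = U * diagonal (fun i => (hA.eigenvalues i : ℂ)) * (Uᴴ * U)
          * diagonal (fun i => (Real.log (hA.eigenvalues i) : ℂ)) * Uᴴ := by
            simp only [Matrix.mul_assoc]
      _ = _ := by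
            rw [hU, Matrix.mul_one, Matrix.mul_assoc U, diagonal_mul_diagonal]
            simp
  rw [vonNeumannEntropy, h, trace_mul_comm, ← Matrix.mul_assoc, hU, Matrix.one_mul, trace_diagonal,
    ← Complex.ofReal_sum, Complex.ofReal_re, ← Finset.sum_neg_distrib]
  simp [Real.negMulLog]

/-- Entropy depends only on the characteristic polynomial, so identities such as that for `charpoly
(A * B)` and `charpoly (B * A)` become equalities of entropies. -/
lemma vonNeumannEntropy_eq_sum_roots {A : Matrix n n ℂ} (hA : A.IsHermitian) :
    vonNeumannEntropy A = (A.charpoly.roots.map fun z => Real.negMulLog z.re).sum := by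
  rw [vonNeumannEntropy_eq_sum_eigenvalues hA, hA.roots_charpoly_eq_eigenvalues, Multiset.map_map]
  simp

lemma vonNeumannEntropy_transpose {A : Matrix n n ℂ} (hA : A.IsHermitian) :
    vonNeumannEntropy Aᵀ = vonNeumannEntropy A := by
  rw [vonNeumannEntropy_eq_sum_roots hA, vonNeumannEntropy_eq_sum_roots hA.transpose,
    charpoly_transpose]

lemma vonNeumannEntropy_conj {A U : Matrix n n ℂ} (hA : A.IsHermitian) (hU : U * Uᴴ = 1) :
    vonNeumannEntropy (Uᴴ * A * U) = vonNeumannEntropy A := by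
  rw [vonNeumannEntropy_eq_sum_roots hA,
    vonNeumannEntropy_eq_sum_roots (isHermitian_conjTranspose_mul_mul U hA), Matrix.mul_assoc,
    charpoly_mul_comm, Matrix.mul_assoc, hU, Matrix.mul_one]

/-- The two marginals of a pure bipartite state have the same entropy. -/
lemma vonNeumannEntropy_mul_conjTranspose_self (M : Matrix m n ℂ) :
    vonNeumannEntropy (M * Mᴴ) = vonNeumannEntropy (Mᴴ * M) := by
  rw [vonNeumannEntropy_eq_sum_roots (isHermitian_mul_conjTranspose_self M),
    vonNeumannEntropy_eq_sum_roots (isHermitian_conjTranspose_mul_self M)]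
  -- The two characteristic polynomials differ by powers of `X`; the extra zero roots contribute
  -- nothing because `negMulLog 0 = 0`.
  have h := congrArg (fun p : ℂ[X] => (p.roots.map fun z => Real.negMulLog z.re).sum)
    (charpoly_mul_comm' M Mᴴ)
  have hne : ∀ (k : ℕ) (p : ℂ[X]), p.Monic → (X ^ k * p) ≠ 0 := fun k p hp =>
    ((monic_X_pow k).mul hp).ne_zero
  simpa [roots_mul (hne _ _ (charpoly_monic _)), Multiset.map_nsmul, Multiset.sum_nsmul] using h

lemma vonNeumannEntropy_diagonal (d : n → ℝ) :
    vonNeumannEntropy (diagonal fun i => (d i : ℂ)) = ∑ i, Real.negMulLog (d i) := by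
  rw [vonNeumannEntropy_eq_sum_roots (isHermitian_diagonal_iff.2 fun i => by
    simp [isSelfAdjoint_iff]), charpoly_diagonal, roots_prod]
  · simp
  · exact Finset.prod_ne_zero_iff.2 fun i _ => X_sub_C_ne_zero _

lemma vonNeumannEntropy_conj_diagonal {U : Matrix n n ℂ} (hU : Uᴴ * U = 1) (d : n → ℝ) :
    vonNeumannEntropy (U * diagonal (fun i => (d i : ℂ)) * Uᴴ) = ∑ i, Real.negMulLog (d i) := by
  have h := vonNeumannEntropy_conj (A := diagonal fun i => (d i : ℂ)) (U := Uᴴ)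
    (isHermitian_diagonal_iff.2 fun i => by simp [isSelfAdjoint_iff]) (by simpa using hU)
  rw [conjTranspose_conjTranspose] at h
  rw [h, vonNeumannEntropy_diagonal]

lemma sum_eigenvalues_eq_one {A : Matrix n n ℂ} (hA : A.IsHermitian) (h : A.trace = 1) :
    ∑ i, hA.eigenvalues i = 1 := by
  have := hA.trace_eq_sum_eigenvalues
  rw [h] at this
  exact Complex.ofReal_injective (by simpa using this.symm)

/-- Entropy is additive on product states. -/
lemma vonNeumannEntropy_kronecker {A : Matrix m m ℂ} {B : Matrix n n ℂ} (hA : A.IsHermitian)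
    (hB : B.IsHermitian) (hA1 : A.trace = 1) (hB1 : B.trace = 1) :
    vonNeumannEntropy (A ⊗ₖ B) = vonNeumannEntropy A + vonNeumannEntropy B := by
  obtain ⟨U, hU, -, hA', -⟩ := hA.exists_diagonalization
  obtain ⟨V, hV, -, hB', -⟩ := hB.exists_diagonalization
  have h : A ⊗ₖ B = (U ⊗ₖ V) *
      diagonal (fun i : m × n => ((hA.eigenvalues i.1 * hB.eigenvalues i.2 : ℝ) : ℂ)) *
      (U ⊗ₖ V)ᴴ := by
    conv_lhs => rw [hA', hB']
    rw [mul_kronecker_mul, mul_kronecker_mul, diagonal_kronecker_diagonal, conjTranspose_kronecker]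
    simp
  have hUV : (U ⊗ₖ V)ᴴ * (U ⊗ₖ V) = 1 := by
    rw [conjTranspose_kronecker, ← mul_kronecker_mul, hU, hV, one_kronecker_one]
  rw [h, vonNeumannEntropy_conj_diagonal hUV, vonNeumannEntropy_eq_sum_eigenvalues hA,
    vonNeumannEntropy_eq_sum_eigenvalues hB, Fintype.sum_prod_type]
  simp only [Real.negMulLog_mul, Finset.sum_add_distrib]
  simp only [← Finset.sum_mul, ← Finset.mul_sum, sum_eigenvalues_eq_one hA hA1,
    sum_eigenvalues_eq_one hB hB1, one_mul]

/-- Measuring in the standard basis does not decrease the entropy. -/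
lemma vonNeumannEntropy_le_sum_diag {A : Matrix n n ℂ} (hA : A.PosSemidef) :
    vonNeumannEntropy A ≤ ∑ i, Real.negMulLog (A i i).re := by
  obtain ⟨U, hU, hU', hA', -⟩ := hA.isHermitian.exists_diagonalization
  set d := hA.isHermitian.eigenvalues
  -- The matrix `|U i j|²` is doubly stochastic and maps the spectrum to the diagonal: row sums
  -- allow Jensen's inequality, column sums recover the entropy.
  have hrow : ∀ i, ∑ j, Complex.normSq (U i j) = 1 := fun i => by
    have := congrFun (congrFun hU' i) i
    simp only [mul_apply, conjTranspose_apply, one_apply_eq, Complex.star_def,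
      Complex.mul_conj] at this
    exact_mod_cast this
  have hcol : ∀ j, ∑ i, Complex.normSq (U i j) = 1 := fun j => by
    have := congrFun (congrFun hU j) j
    simp only [mul_apply, conjTranspose_apply, one_apply_eq, Complex.star_def, mul_comm,
      Complex.mul_conj] at this
    exact_mod_cast this
  have hdiag : ∀ i, (A i i).re = ∑ j, Complex.normSq (U i j) * d j := fun i => by
    have : A i i = ((∑ j, Complex.normSq (U i j) * d j : ℝ) : ℂ) := by
      conv_lhs => rw [hA']
      rw [mul_apply]
      push_cast
      refine Finset.sum_congr rfl fun j _ => ?_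
      rw [mul_diagonal, conjTranspose_apply, ← Complex.mul_conj, Complex.star_def]
      ring
    rw [this, Complex.ofReal_re]
  rw [vonNeumannEntropy_eq_sum_eigenvalues hA.isHermitian]
  calc ∑ j, Real.negMulLog (d j)
      = ∑ j, ∑ i, Complex.normSq (U i j) * Real.negMulLog (d j) := by
        simp only [← Finset.sum_mul, hcol, one_mul]
    _ = ∑ i, ∑ j, Complex.normSq (U i j) * Real.negMulLog (d j) := Finset.sum_comm
    _ ≤ ∑ i, Real.negMulLog (A i i).re := by
        refine Finset.sum_le_sum fun i _ => ?_
        rw [hdiag]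
        simpa using Real.concaveOn_negMulLog.le_map_sum (t := Finset.univ)
          (fun j _ => Complex.normSq_nonneg (U i j)) (hrow i)
          (fun j _ => hA.eigenvalues_nonneg j)

/-- Subadditivity of the Shannon entropy. -/
lemma sum_negMulLog_le_marginals {m n : Type*} [Fintype m] [Fintype n]
    (p : m × n → ℝ) (hp : ∀ i, 0 ≤ p i) (h1 : ∑ i, p i = 1) :
    ∑ i, Real.negMulLog (p i) ≤
      ∑ i, Real.negMulLog (∑ j, p (i, j)) + ∑ j, Real.negMulLog (∑ i, p (i, j)) := by
  set q : m → ℝ := fun i => ∑ j, p (i, j) with hq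
  set s : n → ℝ := fun j => ∑ i, p (i, j) with hs
  -- This is `log t ≤ t - 1` at `t = q s / p`; the correction `q s - p` sums to zero. At `p = 0`
  -- only `0 ≤ q s` is left.
  have key : ∀ i j, Real.negMulLog (p (i, j)) ≤
      -(p (i, j) * Real.log (q i)) + -(p (i, j) * Real.log (s j)) + (q i * s j - p (i, j)) := by
    intro i j
    have hpq : p (i, j) ≤ q i :=
      Finset.single_le_sum (f := fun j => p (i, j)) (fun j _ => hp _) (Finset.mem_univ j)
    have hps : p (i, j) ≤ s j :=
      Finset.single_le_sum (f := fun i => p (i, j)) (fun i _ => hp _) (Finset.mem_univ i)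
    rcases (hp (i, j)).eq_or_lt with h | h
    · rw [← h] at hpq hps ⊢
      simpa using mul_nonneg hpq hps
    · have hq0 := h.trans_le hpq
      have hs0 := h.trans_le hps
      have hlog := Real.log_le_sub_one_of_pos (div_pos (mul_pos hq0 hs0) h)
      rw [Real.log_div (mul_pos hq0 hs0).ne' h.ne', Real.log_mul hq0.ne' hs0.ne'] at hlog
      have := mul_le_mul_of_nonneg_left hlog h.le
      rw [mul_sub (p (i, j)) (q i * s j / p (i, j)), mul_div_cancel₀ _ h.ne'] at this
      rw [Real.negMulLog]
      linarith
  have hqs : ∑ i, ∑ j, q i * s j = 1 := by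
    rw [← Finset.sum_mul_sum]
    have hq1 : ∑ i, q i = 1 := by rw [← h1, Fintype.sum_prod_type]
    have hs1 : ∑ j, s j = 1 := by rw [← h1, Fintype.sum_prod_type_right]
    rw [hq1, hs1, one_mul]
  have hpp : ∑ i, ∑ j, p (i, j) = 1 := by rw [← h1, Fintype.sum_prod_type]
  calc ∑ i, Real.negMulLog (p i) = ∑ i, ∑ j, Real.negMulLog (p (i, j)) := Fintype.sum_prod_type _
    _ ≤ ∑ i, ∑ j, (-(p (i, j) * Real.log (q i)) + -(p (i, j) * Real.log (s j)) +
          (q i * s j - p (i, j))) :=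
        Finset.sum_le_sum fun i _ => Finset.sum_le_sum fun j _ => key i j
    _ = ∑ i, ∑ j, -(p (i, j) * Real.log (q i)) + ∑ i, ∑ j, -(p (i, j) * Real.log (s j)) := by
        simp only [Finset.sum_add_distrib, Finset.sum_sub_distrib, hqs, hpp, sub_self, add_zero]
    _ = _ := by
        congr 1
        · refine Finset.sum_congr rfl fun i _ => ?_
          rw [Finset.sum_neg_distrib, ← Finset.sum_mul, Real.negMulLog, neg_mul]
        · rw [Finset.sum_comm]
          refine Finset.sum_congr rfl fun j _ => ?_
          rw [Finset.sum_neg_distrib, ← Finset.sum_mul, Real.negMulLog, neg_mul]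

/-- The partial trace over the second factor. -/
def Matrix.fstMarginal {m n : Type*} [Fintype n] (ρ : Matrix (m × n) (m × n) ℂ) : Matrix m m ℂ :=
  of fun i k => ∑ j, ρ (i, j) (k, j)

/-- The partial trace over the first factor. -/
def Matrix.sndMarginal {m n : Type*} [Fintype m] (ρ : Matrix (m × n) (m × n) ℂ) : Matrix n n ℂ :=
  of fun j l => ∑ i, ρ (i, j) (i, l)

/-- A unitary on the factor traced out has no effect, by orthonormality of its rows. -/
lemma Matrix.fstMarginal_conj {m n : Type*} [Fintype m] [Fintype n] [DecidableEq n]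
    (P : Matrix m m ℂ) {Q : Matrix n n ℂ} (hQ : Q * Qᴴ = 1) (ρ : Matrix (m × n) (m × n) ℂ) :
    fstMarginal ((P ⊗ₖ Q)ᴴ * ρ * (P ⊗ₖ Q)) = Pᴴ * fstMarginal ρ * P := by
  have hQ' : ∀ j l, ∑ b, star (Q j b) * Q l b = if l = j then 1 else 0 := fun j l => by
    have := congrFun (congrFun hQ l) j
    simpa [mul_apply, one_apply, mul_comm] using this
  ext a c
  simp only [fstMarginal, of_apply, mul_apply, Fintype.sum_prod_type, conjTranspose_apply,
    kronecker_apply, star_mul', Finset.sum_mul, Finset.mul_sum]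
  calc _ = ∑ k, ∑ l, ∑ i, ∑ j, star (P i a) * ρ (i, j) (k, l) * P k c *
          ∑ b, star (Q j b) * Q l b := by
        simp only [Finset.mul_sum]
        rw [Finset.sum_comm]
        refine Finset.sum_congr rfl fun k _ => ?_
        rw [Finset.sum_comm]
        refine Finset.sum_congr rfl fun l _ => ?_
        rw [Finset.sum_comm]
        refine Finset.sum_congr rfl fun i _ => ?_
        rw [Finset.sum_comm]
        refine Finset.sum_congr rfl fun j _ => Finset.sum_congr rfl fun b _ => ?_
        ring
    _ = _ := by
        refine Finset.sum_congr rfl fun k _ => ?_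
        rw [Finset.sum_comm]
        simp only [hQ', mul_ite, mul_one, mul_zero, Finset.sum_ite_eq, Finset.mem_univ, if_true]

lemma Matrix.sndMarginal_conj {m n : Type*} [Fintype m] [Fintype n] [DecidableEq m]
    {P : Matrix m m ℂ} (Q : Matrix n n ℂ) (hP : P * Pᴴ = 1) (ρ : Matrix (m × n) (m × n) ℂ) :
    sndMarginal ((P ⊗ₖ Q)ᴴ * ρ * (P ⊗ₖ Q)) = Qᴴ * sndMarginal ρ * Q := by
  have h := fstMarginal_conj Q hP (ρ.submatrix Prod.swap Prod.swap)
  have hs : (P ⊗ₖ Q).submatrix Prod.swap Prod.swap = Q ⊗ₖ P := by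
    ext i j
    simp [mul_comm]
  have hswap : ∀ τ : Matrix (m × n) (m × n) ℂ,
      fstMarginal (τ.submatrix Prod.swap Prod.swap) = sndMarginal τ := fun τ => rfl
  rw [hswap, ← hs, conjTranspose_submatrix,
    ← submatrix_mul _ _ _ Prod.swap _ Prod.swap_bijective,
    ← submatrix_mul _ _ _ Prod.swap _ Prod.swap_bijective, hswap] at h
  exact h

lemma Matrix.PosSemidef.fstMarginal {m n : Type*} [Fintype m] [Fintype n]
    {ρ : Matrix (m × n) (m × n) ℂ} (h : ρ.PosSemidef) : ρ.fstMarginal.PosSemidef := by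
  have : ρ.fstMarginal = ∑ j, ρ.submatrix (fun i => (i, j)) (fun i => (i, j)) := by
    ext i k
    simp [Matrix.fstMarginal, Matrix.sum_apply]
  rw [this]
  exact posSemidef_sum _ fun j _ => h.submatrix _

lemma Matrix.PosSemidef.sndMarginal {m n : Type*} [Fintype m] [Fintype n]
    {ρ : Matrix (m × n) (m × n) ℂ} (h : ρ.PosSemidef) : ρ.sndMarginal.PosSemidef :=
  (h.submatrix Prod.swap).fstMarginal

lemma Matrix.conj_conjTranspose_cancel {T : Matrix n n ℂ} (D : Matrix n n ℂ) (hT : Tᴴ * T = 1) :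
    Tᴴ * (T * D * Tᴴ) * T = D := by
  calc _ = (Tᴴ * T) * D * (Tᴴ * T) := by simp only [Matrix.mul_assoc]
    _ = D := by rw [hT, Matrix.one_mul, Matrix.mul_one]

/-- Subadditivity of the von Neumann entropy. -/
lemma vonNeumannEntropy_le_marginals {ρ : Matrix (m × n) (m × n) ℂ} (h : ρ.PosSemidef)
    (h1 : ρ.trace = 1) :
    vonNeumannEntropy ρ ≤ vonNeumannEntropy ρ.fstMarginal + vonNeumannEntropy ρ.sndMarginal := by
  obtain ⟨U, hU, hU', hA, -⟩ := h.fstMarginal.isHermitian.exists_diagonalization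
  obtain ⟨V, hV, hV', hB, -⟩ := h.sndMarginal.isHermitian.exists_diagonalization
  have hUV : (U ⊗ₖ V) * (U ⊗ₖ V)ᴴ = 1 := by
    rw [conjTranspose_kronecker, ← mul_kronecker_mul, hU', hV', one_kronecker_one]
  -- In the product of the eigenbases of the marginals, the diagonal of the state is a joint
  -- distribution whose marginals are the two spectra, which reduces the claim to Shannon entropy.
  set τ := (U ⊗ₖ V)ᴴ * ρ * (U ⊗ₖ V) with hτ
  have hτp : τ.PosSemidef := h.conjTranspose_mul_mul_same _
  have hτ1 : τ.trace = 1 := by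
    rw [hτ, Matrix.mul_assoc, trace_mul_comm, Matrix.mul_assoc, hUV, Matrix.mul_one, h1]
  have hf : ∀ i, ∑ j, (τ (i, j) (i, j)).re = h.fstMarginal.isHermitian.eigenvalues i := fun i => by
    have h2 := fstMarginal_conj U hV' ρ
    rw [hA, Matrix.conj_conjTranspose_cancel _ hU, ← hτ] at h2
    have := congrArg Complex.re (congrFun (congrFun h2 i) i)
    simpa [Matrix.fstMarginal] using this
  have hs : ∀ j, ∑ i, (τ (i, j) (i, j)).re = h.sndMarginal.isHermitian.eigenvalues j := fun j => by
    have h2 := sndMarginal_conj V hU' ρ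
    rw [hB, Matrix.conj_conjTranspose_cancel _ hV, ← hτ] at h2
    have := congrArg Complex.re (congrFun (congrFun h2 j) j)
    simpa [Matrix.sndMarginal] using this
  rw [← vonNeumannEntropy_conj h.isHermitian hUV, ← hτ,
    vonNeumannEntropy_eq_sum_eigenvalues h.fstMarginal.isHermitian,
    vonNeumannEntropy_eq_sum_eigenvalues h.sndMarginal.isHermitian]
  refine (vonNeumannEntropy_le_sum_diag hτp).trans ?_
  have := sum_negMulLog_le_marginals (fun i : m × n => (τ i i).re)
    (fun i => (Complex.le_def.1 hτp.diag_nonneg).1)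
    (by simpa [trace] using congrArg Complex.re hτ1)
  simpa only [hf, hs] using this

end Entropy

/-! ### Kraus decompositions and correctable channels. -/

section Kraus

open Matrix

variable {a b : Type*} [Fintype a] [DecidableEq a] [Fintype b] [DecidableEq b]

lemma exists_eq_star_mul_self_of_nonneg {A : Type*} [NonUnitalCStarAlgebra A] [PartialOrder A]
    [StarOrderedRing A] {x : A} (hx : 0 ≤ x) : ∃ y, x = star y * y :=
  CStarAlgebra.nonneg_iff_eq_star_mul_self.1 hx

section

open scoped CStarAlgebra Matrix.Norms.L2Operator MatrixOrder

/-- **Choi's theorem**, in entries: a quantum operation has a Kraus decomposition. -/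
lemma QuantumOperation.exists_kraus_single (E : QuantumOperation a b) :
    ∃ K : a × b → Matrix b a ℂ, ∀ i j p q,
      E.lin (Matrix.single i j 1) p q = ∑ k, K k p i * star (K k q j) := by
  rcases isEmpty_or_nonempty a with ha | ⟨⟨i₀⟩⟩
  · exact ⟨0, fun i => isEmptyElim i⟩
  -- `Ω` is the Choi matrix; `B`, with the single nonzero row `i₀`, witnesses its positivity through
  -- `Ω = star B * B`.
  let Ω : CStarMatrix a a (Matrix a a ℂ) := CStarMatrix.ofMatrix fun i j => Matrix.single i j 1
  let B : CStarMatrix a a (Matrix a a ℂ) :=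
    CStarMatrix.ofMatrix fun k j => if k = i₀ then Matrix.single i₀ j 1 else 0
  have hΩ : 0 ≤ Ω := by
    have : Ω = star B * B := by
      have hB : ∀ k j, B k j = if k = i₀ then Matrix.single i₀ j 1 else 0 := fun _ _ => rfl
      have hΩ' : ∀ i j, Ω i j = Matrix.single i j 1 := fun _ _ => rfl
      refine CStarMatrix.ext fun i j => ?_
      rw [CStarMatrix.mul_apply, Finset.sum_eq_single i₀]
      · simp [hB, hΩ', CStarMatrix.star_apply, star_eq_conjTranspose]
      · intro k _ hk
        simp [hB, hk]
      · simp
    rw [this]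
    exact star_mul_self_nonneg B
  have h := E.toCompletelyPositiveMap.map_cstarMatrix_nonneg Ω hΩ
  obtain ⟨C, hC⟩ := exists_eq_star_mul_self_of_nonneg h
  -- Each Kraus operator comes from one block row and one inner row of the factor `C` of the image
  -- of `Ω`.
  refine ⟨fun k => of fun p i => star (C k.1 i k.2 p), fun i j p q => ?_⟩
  have h2 : E.lin (Matrix.single i j 1) = ∑ k, star (C k i) * C k j := by
    have := congrFun (congrFun hC i) j
    rw [CStarMatrix.mul_apply] at this
    exact this
  rw [h2, Fintype.sum_prod_type, Matrix.sum_apply]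
  simp [mul_apply, star_eq_conjTranspose]

lemma Matrix.PosSemidef.exists_eq_mul_conjTranspose_self {A : Matrix a a ℂ} (hA : A.PosSemidef) :
    ∃ B : Matrix a a ℂ, A = B * Bᴴ := by
  obtain ⟨C, hC⟩ := exists_eq_star_mul_self_of_nonneg (Matrix.nonneg_iff_posSemidef.2 hA)
  exact ⟨Cᴴ, by rw [conjTranspose_conjTranspose]; exact hC⟩

/-- Positive matrices span, and each is zero or a positive multiple of a state. Identities known on
states thus extend to matrix units. -/
lemma LinearMap.eq_zero_of_densityOperators {M : Type*} [AddCommGroup M] [Module ℂ M]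
    (L : Matrix a a ℂ →ₗ[ℂ] M) (h : ∀ ρ ∈ densityOperators a, L ρ = 0) : L = 0 := by
  refine LinearMap.ext_on (CStarAlgebra.span_nonneg (A := Matrix a a ℂ)) fun A hA => ?_
  have hA' : A.PosSemidef := Matrix.nonneg_iff_posSemidef.1 hA
  rcases eq_or_ne A.trace 0 with h0 | h0
  · rw [hA'.trace_eq_zero_iff.1 h0, map_zero, map_zero]
  · have hρ : A.trace⁻¹ • A ∈ densityOperators a :=
      ⟨hA'.smul (by have := hA'.trace_nonneg; exact inv_nonneg.2 this), by simp [h0]⟩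
    have := h _ hρ
    rw [map_smul, smul_eq_zero] at this
    simpa [h0] using this

end

lemma QuantumOperation.exists_kraus (E : QuantumOperation a b) :
    ∃ K : a × b → Matrix b a ℂ,
      (∀ ρ, E.lin ρ = ∑ k, K k * ρ * (K k)ᴴ) ∧ ∑ k, (K k)ᴴ * K k = 1 := by
  obtain ⟨K, hK⟩ := E.exists_kraus_single
  have hsum : ∀ ρ, E.lin ρ = ∑ k, K k * ρ * (K k)ᴴ := by
    let F : Matrix a a ℂ →ₗ[ℂ] Matrix b b ℂ :=
      { toFun := fun ρ => ∑ k, K k * ρ * (K k)ᴴ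
        map_add' := fun x y => by simp [Matrix.mul_add, Matrix.add_mul, Finset.sum_add_distrib]
        map_smul' := fun c x => by simp [Finset.smul_sum] }
    have : E.lin = F := by
      refine Matrix.ext_linearMap _ fun i j => LinearMap.ext_ring ?_
      ext p q
      simp only [LinearMap.comp_apply, singleLinearMap_apply, hK, F, LinearMap.coe_mk, AddHom.coe_mk,
        Matrix.sum_apply]
      refine Finset.sum_congr rfl fun k _ => ?_
      simp [mul_apply, Matrix.single_apply, ite_and]
    exact fun ρ => by rw [this]; rfl
  refine ⟨K, hsum, ?_⟩
  -- The completeness relation is trace preservation tested against every `ρ`.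
  refine Matrix.ext_iff_trace_mul_left.2 fun ρ => ?_
  have h := E.trace_map' ρ
  change (E.lin ρ).trace = _ at h
  rw [Matrix.mul_one, ← h, hsum, trace_sum, Matrix.mul_sum, trace_sum]
  refine Finset.sum_congr rfl fun k _ => ?_
  rw [← Matrix.mul_assoc, trace_mul_cycle]

/-- Kraus operators of the identity channel are scalar. -/
lemma exists_eq_smul_one_of_kraus_id {κ : Type*} [Fintype κ] (A : κ → Matrix a a ℂ)
    (hA : ∀ ρ, ∑ k, A k * ρ * (A k)ᴴ = ρ) : ∃ c : κ → ℂ, ∀ k, A k = c k • 1 := by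
  have h : ∀ s p t q, ∑ k, A k s p * star (A k t q) = if s = p ∧ t = q then 1 else 0 := by
    intro s p t q
    have := congrFun (congrFun (hA (Matrix.single p q 1)) s) t
    rw [Matrix.sum_apply] at this
    simpa [mul_apply, Matrix.single_apply, Finset.sum_mul, ite_and, eq_comm] using this
  -- Applied to off-diagonal entries and to differences of diagonal ones, whose squared norms are
  -- `0` and `1 - 1 - 1 + 1`.
  have hsq : ∀ f : κ → ℂ, ∑ k, f k * star (f k) = 0 → ∀ k, f k = 0 := by
    intro f hf k
    have h0 := (Finset.sum_eq_zero_iff_of_nonneg fun k _ => mul_star_self_nonneg (f k)).1 hf k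
      (Finset.mem_univ k)
    simpa using h0
  rcases isEmpty_or_nonempty a with ha | ⟨⟨s₀⟩⟩
  · exact ⟨0, fun k => Subsingleton.elim _ _⟩
  refine ⟨fun k => A k s₀ s₀, fun k => ?_⟩
  ext s p
  rcases eq_or_ne s p with rfl | hsp
  · have := hsq (fun k => A k s s - A k s₀ s₀) (by
      simp only [star_sub, mul_sub, sub_mul, Finset.sum_sub_distrib, h]
      simp) k
    simpa [sub_eq_zero] using this
  · have := hsq (fun k => A k s p) (by rw [h]; simp [hsp]) k
    simpa [hsp] using this

/-- The Knill–Laflamme condition: the Kraus operators `T` of a correctable channel satisfy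
`Tᵢᴴ Tⱼ ∈ ℂ 1`. -/
lemma exists_conjTranspose_mul_eq_smul_one {κ κ' : Type*} [Fintype κ] [Fintype κ']
    (T : κ → Matrix b a ℂ) (S : κ' → Matrix a b ℂ) (hS : ∑ k, (S k)ᴴ * S k = 1)
    (h : ∀ ρ : Matrix a a ℂ, ∑ k, S k * (∑ e, T e * ρ * (T e)ᴴ) * (S k)ᴴ = ρ) :
    ∃ γ : Matrix κ κ ℂ, ∀ e f, (T e)ᴴ * T f = γ e f • 1 := by
  -- The products `S k * T e` are Kraus operators of the identity channel, hence scalars.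
  obtain ⟨c, hc⟩ := exists_eq_smul_one_of_kraus_id (fun k : κ' × κ => S k.1 * T k.2) fun ρ => by
    rw [Fintype.sum_prod_type]
    simpa [Matrix.mul_sum, Matrix.sum_mul, Matrix.mul_assoc] using h ρ
  refine ⟨of fun e f => ∑ k, star (c (k, e)) * c (k, f), fun e f => ?_⟩
  calc (T e)ᴴ * T f = (T e)ᴴ * (∑ k, (S k)ᴴ * S k) * T f := by rw [hS, Matrix.mul_one]
    _ = ∑ k, (S k * T e)ᴴ * (S k * T f) := by
        simp [Matrix.mul_sum, Matrix.sum_mul, Matrix.mul_assoc]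
    _ = _ := by
        simp only [of_apply, Finset.sum_smul]
        refine Finset.sum_congr rfl fun k _ => ?_
        rw [hc (k, e), hc (k, f)]
        simp [smul_smul, mul_comm]

end Kraus

/-! ### Entropy inequalities for four-party pure states. -/

section Tensor

open Matrix
open scoped Kronecker

variable {r x y e a : Type*} [Fintype r] [DecidableEq r] [Fintype x] [DecidableEq x]
  [Fintype y] [DecidableEq y] [Fintype e] [DecidableEq e] [Fintype a] [DecidableEq a]

/-- If in a pure state `Φ` of four systems `r, x, y, e` the marginal on `r` and `e` is a product
state, then `H(r) + H(e) ≤ H(x) + H(y)`. -/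
lemma vonNeumannEntropy_add_le_of_product_marginal (Φ : r → x → y → e → ℂ)
    (hΦ : ∑ i, ∑ j, ∑ k, ∑ l, Φ i j k l * star (Φ i j k l) = 1) {σ : Matrix r r ℂ}
    {γ : Matrix e e ℂ} (hσ : σ.IsHermitian) (hσ1 : σ.trace = 1)
    (hprod : ∀ i i' l l', ∑ j, ∑ k, Φ i j k l * star (Φ i' j k l') = σ i i' * γ l l') :
    vonNeumannEntropy σ +
        vonNeumannEntropy (of fun l l' => ∑ i, ∑ j, ∑ k, Φ i j k l * star (Φ i j k l')) ≤
      vonNeumannEntropy (of fun j j' => ∑ i, ∑ k, ∑ l, Φ i j k l * star (Φ i j' k l)) +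
        vonNeumannEntropy (of fun k k' => ∑ i, ∑ j, ∑ l, Φ i j k l * star (Φ i j k' l)) := by
  -- `Φ` cut as `re | xy`: `M * Mᴴ` is the marginal on `re`, and the transpose of `Mᴴ * M` is that
  -- on `xy`.
  let M : Matrix (r × e) (x × y) ℂ := of fun p q => Φ p.1 q.1 q.2 p.2
  have hM : M * Mᴴ = σ ⊗ₖ γ := by
    ext p q
    simp only [M, mul_apply, conjTranspose_apply, of_apply, Fintype.sum_prod_type, hprod]
    rfl
  have hγ : (of fun l l' => ∑ i, ∑ j, ∑ k, Φ i j k l * star (Φ i j k l')) = γ := by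
    ext l l'
    simp only [of_apply, hprod]
    rw [← Finset.sum_mul]
    change σ.trace * _ = _
    rw [hσ1, one_mul]
  have hγh : γ.IsHermitian := by
    rw [← hγ]
    ext l l'
    simp [mul_comm]
  have hγ1 : γ.trace = 1 := by
    rw [← hγ, ← hΦ, trace]
    simp only [diag_apply, of_apply]
    rw [Finset.sum_comm]
    refine Finset.sum_congr rfl fun i _ => ?_
    rw [Finset.sum_comm]
    refine Finset.sum_congr rfl fun j _ => ?_
    rw [Finset.sum_comm]
  have hT : (Mᵀ * Mᵀᴴ).PosSemidef := posSemidef_self_mul_conjTranspose _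
  have htr : (Mᵀ * Mᵀᴴ) = (Mᴴ * M)ᵀ := by rw [transpose_mul]; rfl
  have hT1 : (Mᵀ * Mᵀᴴ).trace = 1 := by
    rw [htr, trace_transpose, trace_mul_comm, hM, trace_kronecker, hσ1, hγ1, one_mul]
  have hf : (Mᵀ * Mᵀᴴ).fstMarginal =
      of fun j j' => ∑ i, ∑ k, ∑ l, Φ i j k l * star (Φ i j' k l) := by
    ext j j'
    simp only [fstMarginal, of_apply, mul_apply, conjTranspose_apply, transpose_apply, M,
      Fintype.sum_prod_type]
    rw [Finset.sum_comm]
  have hs : (Mᵀ * Mᵀᴴ).sndMarginal =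
      of fun k k' => ∑ i, ∑ j, ∑ l, Φ i j k l * star (Φ i j k' l) := by
    ext j j'
    simp only [sndMarginal, of_apply, mul_apply, conjTranspose_apply, transpose_apply, M,
      Fintype.sum_prod_type]
    rw [Finset.sum_comm]
  rw [hγ, ← vonNeumannEntropy_kronecker hσ hγh hσ1 hγ1, ← hM,
    vonNeumannEntropy_mul_conjTranspose_self,
    ← vonNeumannEntropy_transpose (isHermitian_conjTranspose_mul_self M), ← htr, ← hf, ← hs]
  exact vonNeumannEntropy_le_marginals hT hT1

/-- If in a pure state `Φ` of four systems `r, x, y, e` both `y` and `e` are uncorrelated with `r`,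
then `H(r) ≤ H(x)`. -/
lemma vonNeumannEntropy_le_of_product_marginals (Φ : r → x → y → e → ℂ)
    (hΦ : ∑ i, ∑ j, ∑ k, ∑ l, Φ i j k l * star (Φ i j k l) = 1) {σ : Matrix r r ℂ}
    {β : Matrix y y ℂ} {γ : Matrix e e ℂ} (hσ : σ.IsHermitian) (hσ1 : σ.trace = 1)
    (hy : ∀ i i' k k', ∑ j, ∑ l, Φ i j k l * star (Φ i' j k' l) = σ i i' * β k k')
    (he : ∀ i i' l l', ∑ j, ∑ k, Φ i j k l * star (Φ i' j k l') = σ i i' * γ l l') :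
    vonNeumannEntropy σ ≤
      vonNeumannEntropy (of fun j j' => ∑ i, ∑ k, ∑ l, Φ i j k l * star (Φ i j' k l)) := by
  have h1 := vonNeumannEntropy_add_le_of_product_marginal Φ hΦ hσ hσ1 he
  have h2 := vonNeumannEntropy_add_le_of_product_marginal (fun i j l k => Φ i j k l)
    (by
      rw [← hΦ]
      refine Finset.sum_congr rfl fun i _ => Finset.sum_congr rfl fun j _ => ?_
      rw [Finset.sum_comm]) hσ hσ1 hy
  have hx : (of fun j j' => ∑ i, ∑ l, ∑ k, Φ i j k l * star (Φ i j' k l)) =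
      of fun j j' => ∑ i, ∑ k, ∑ l, Φ i j k l * star (Φ i j' k l) := by
    ext j j'
    refine Finset.sum_congr rfl fun i _ => ?_
    rw [Finset.sum_comm]
  rw [hx] at h2
  linarith

/-- If summing over the unobserved indices `q` yields a multiple of the identity, feeding in `B`
leaves that scalar times the reference state `(Bᴴ * B)ᵀ`: the product form of the marginal. -/
lemma sum_mul_apply_mul_star {r κ : Type*} [Fintype κ] (F G : κ → a → ℂ) (B : Matrix a r ℂ)
    (c : ℂ) (h : ∀ s t, ∑ q, F q s * star (G q t) = if s = t then c else 0) (i i' : r) :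
    ∑ q, (∑ s, F q s * B s i) * star (∑ t, G q t * B t i') = (Bᴴ * B)ᵀ i i' * c := by
  calc _ = ∑ s, ∑ t, (∑ q, F q s * star (G q t)) * (B s i * star (B t i')) := by
        simp only [star_sum, star_mul', Finset.sum_mul_sum]
        rw [Finset.sum_comm]
        refine Finset.sum_congr rfl fun s _ => ?_
        rw [Finset.sum_comm]
        refine Finset.sum_congr rfl fun t _ => ?_
        rw [Finset.sum_mul]
        refine Finset.sum_congr rfl fun q _ => ?_
        ring
    _ = _ := by
        simp only [h, ite_mul, zero_mul, Finset.sum_ite_eq, Finset.mem_univ, if_true,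
          transpose_apply, mul_apply, conjTranspose_apply, Finset.sum_mul]
        refine Finset.sum_congr rfl fun s _ => ?_
        ring

/-- If an isometry `V` from `a` to three systems `x, y, e` reveals nothing of its input to `y`
alone and to `e` alone, then the output at `x` has at least the entropy of the input. -/
lemma vonNeumannEntropy_le_of_isometry (V : Matrix (x × y × e) a ℂ) (hV : Vᴴ * V = 1)
    {β : Matrix y y ℂ} {γ : Matrix e e ℂ}
    (hy : ∀ k k' s t, ∑ j, ∑ l, V (j, k, l) s * star (V (j, k', l) t) =
      if s = t then β k k' else 0)
    (he : ∀ l l' s t, ∑ j, ∑ k, V (j, k, l) s * star (V (j, k, l') t) =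
      if s = t then γ l l' else 0)
    {ρ : Matrix a a ℂ} (hρ : ρ ∈ densityOperators a) :
    vonNeumannEntropy ρ ≤
      vonNeumannEntropy (of fun j j' => ∑ k, ∑ l, (V * ρ * Vᴴ) (j, k, l) (j', k, l)) := by
  -- `B`, read as a vector, purifies `ρ`; its column index is the reference system.
  obtain ⟨B, hρB⟩ := hρ.1.exists_eq_mul_conjTranspose_self
  have hB1 : (Bᴴ * B).trace = 1 := by rw [trace_mul_comm, ← hρB, hρ.2]
  have hσ : vonNeumannEntropy ρ = vonNeumannEntropy (Bᴴ * B)ᵀ := by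
    rw [vonNeumannEntropy_transpose (isHermitian_conjTranspose_mul_self B), hρB,
      vonNeumannEntropy_mul_conjTranspose_self]
  have hx : (of fun j j' => ∑ k, ∑ l, (V * ρ * Vᴴ) (j, k, l) (j', k, l)) =
      of fun j j' => ∑ i, ∑ k, ∑ l, (V * B) (j, k, l) i * star ((V * B) (j', k, l) i) := by
    ext j j'
    have : V * ρ * Vᴴ = (V * B) * (V * B)ᴴ := by
      rw [hρB, conjTranspose_mul]; simp only [Matrix.mul_assoc]
    simp only [of_apply, this, mul_apply (M := V * B), conjTranspose_apply]
    symm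
    rw [Finset.sum_comm]
    refine Finset.sum_congr rfl fun k _ => ?_
    rw [Finset.sum_comm]
  rw [hσ, hx]
  refine vonNeumannEntropy_le_of_product_marginals (fun i j k l => (V * B) (j, k, l) i) ?_
    (isHermitian_conjTranspose_mul_self B).transpose (by rw [trace_transpose, hB1])
    (β := β) (γ := γ) (fun i i' k k' => ?_) (fun i i' l l' => ?_)
  · have : ((V * B)ᴴ * (V * B)).trace = 1 := by
      rw [conjTranspose_mul, Matrix.mul_assoc, ← Matrix.mul_assoc Vᴴ, hV, Matrix.one_mul, hB1]
    rw [← this, trace]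
    refine Finset.sum_congr rfl fun i _ => ?_
    simp only [diag_apply, mul_apply (M := (V * B)ᴴ), Fintype.sum_prod_type, conjTranspose_apply,
      mul_comm]
  · have := sum_mul_apply_mul_star (fun q : x × e => V (q.1, k, q.2))
      (fun q : x × e => V (q.1, k', q.2)) B (β k k')
      (fun s t => by rw [Fintype.sum_prod_type]; exact hy k k' s t) i i'
    rw [Fintype.sum_prod_type] at this
    exact this
  · have := sum_mul_apply_mul_star (fun q : x × y => V (q.1, q.2, l))
      (fun q : x × y => V (q.1, q.2, l')) B (γ l l')
      (fun s t => by rw [Fintype.sum_prod_type]; exact he l l' s t) i i'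
    rw [Fintype.sum_prod_type] at this
    exact this

end Tensor

/-! ### The average state is a density operator. -/

section Average

open Matrix

variable {a : Type*} [Fintype a]

lemma norm_le_one_of_mem_pureStates {ρ : Matrix a a ℂ} (hρ : ρ ∈ pureStates a) (i j : a) :
    ‖ρ i j‖ ≤ 1 := by
  obtain ⟨ψ, hψ, rfl⟩ := hρ
  have h : ∑ k, ‖ψ k‖ ^ 2 = 1 := by
    have h0 : ((∑ k, ‖ψ k‖ ^ 2 : ℝ) : ℂ) = 1 := by
      rw [← hψ, dotProduct]
      push_cast
      exact Finset.sum_congr rfl fun k _ => (Complex.conj_mul' (ψ k)).symm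
    exact_mod_cast h0
  have hle : ∀ k, ‖ψ k‖ ≤ 1 := fun k => by
    have := Finset.single_le_sum (f := fun k => ‖ψ k‖ ^ 2) (fun k _ => by positivity)
      (Finset.mem_univ k)
    rw [h] at this
    exact (sq_le_one_iff₀ (norm_nonneg _)).1 this
  rw [vecMulVec_apply, Pi.star_apply, norm_mul, norm_star]
  exact mul_le_one₀ (hle i) (norm_nonneg _) (hle j)

lemma pureStates_subset_densityOperators : pureStates a ⊆ densityOperators a := by
  rintro _ ⟨ψ, hψ, rfl⟩
  exact ⟨posSemidef_vecMulVec_self_star ψ, by rw [trace_vecMulVec, dotProduct_comm, hψ]⟩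

lemma averageState_mem_densityOperators [MeasurableSpace (pureStates a)] [BorelSpace (pureStates a)]
    (μ : Measure (pureStates a)) [IsProbabilityMeasure μ] :
    averageState μ ∈ densityOperators a := by
  have hint : ∀ i j, Integrable (fun ρ : pureStates a => (ρ : Matrix a a ℂ) i j) μ := fun i j => by
    refine Integrable.of_bound ?_ 1
      (Filter.Eventually.of_forall fun ρ => norm_le_one_of_mem_pureStates ρ.2 i j)
    have : Continuous fun ρ : pureStates a => (ρ : Matrix a a ℂ) i j :=
      continuous_subtype_val.matrix_elem i j
    exact this.measurable.aestronglyMeasurable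
  refine ⟨.of_dotProduct_mulVec_nonneg ?_ fun v => ?_, ?_⟩
  · ext i j
    simp only [averageState, conjTranspose_apply, of_apply]
    rw [Complex.star_def, ← integral_conj]
    refine integral_congr_ae (Filter.Eventually.of_forall fun ρ => ?_)
    exact congrFun (congrFun (pureStates_subset_densityOperators ρ.2).1.isHermitian i) j
  · have : star v ⬝ᵥ (averageState μ *ᵥ v) =
        ∫ ρ : pureStates a, star v ⬝ᵥ ((ρ : Matrix a a ℂ) *ᵥ v) ∂μ := by
      simp only [dotProduct, mulVec, averageState, of_apply, Finset.mul_sum]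
      rw [integral_finsetSum _ fun i _ => integrable_finsetSum _ fun j _ =>
        ((hint i j).mul_const _).const_mul _]
      refine Finset.sum_congr rfl fun i _ => ?_
      rw [integral_finsetSum _ fun j _ => ((hint i j).mul_const _).const_mul _]
      refine Finset.sum_congr rfl fun j _ => ?_
      rw [integral_const_mul, integral_mul_const]
    rw [this]
    exact integral_nonneg fun ρ =>
      (pureStates_subset_densityOperators ρ.2).1.dotProduct_mulVec_nonneg v
  · calc (averageState μ).trace = ∫ ρ : pureStates a, (ρ : Matrix a a ℂ).trace ∂μ := by
          simp only [trace, diag_apply, averageState, of_apply]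
          rw [integral_finsetSum _ fun i _ => hint i i]
      _ = ∫ _ : pureStates a, (1 : ℂ) ∂μ :=
          integral_congr_ae (Filter.Eventually.of_forall fun ρ =>
            (pureStates_subset_densityOperators ρ.2).2)
      _ = 1 := by simp

end Average

/-! ### Splitting indices of shares; constancy on forbidden sets. -/

section ShareSplitting

open Matrix

/-- A family indexed by `p` is a pair of families indexed by the parts `q` and `s` of `p`. -/
def Equiv.piSubtypeSplit {ι : Type*} {p q s : ι → Prop} (b : ι → Type*) [DecidablePred q]
    (h : ∀ i, p i ↔ q i ∨ s i) (hd : ∀ i, q i → ¬ s i) :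
    (∀ i : {i // p i}, b i) ≃ (∀ i : {i // q i}, b i) × (∀ i : {i // s i}, b i) where
  toFun f := (fun i => f ⟨i, (h i).2 (.inl i.2)⟩, fun i => f ⟨i, (h i).2 (.inr i.2)⟩)
  invFun f i := if hq : q i then f.1 ⟨i, hq⟩ else f.2 ⟨i, ((h i).1 i.2).resolve_left hq⟩
  left_inv f := by
    funext i
    by_cases hq : q i <;> simp [hq]
  right_inv f := by
    refine Prod.ext (funext fun i => ?_) (funext fun i => ?_)
    · simp [i.2]
    · have : ¬ q i := fun hq => hd i hq i.2
      simp [this]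

variable {ι : Type*} [Fintype ι] [DecidableEq ι]
  {b : ι → Type*} [∀ i, Fintype (b i)] [∀ i, DecidableEq (b i)]
  {a : Type*} [Fintype a] [DecidableEq a]

lemma sum_glueIndex {ι : Type*} [Fintype ι] [DecidableEq ι] {b : ι → Type*} [∀ i, Fintype (b i)]
    {M : Type*} [AddCommMonoid M] (X : Finset ι) (g : (∀ i, b i) → M) :
    ∑ f, g f = ∑ u, ∑ w, g (glueIndex X u w) := by
  rw [← Fintype.sum_prod_type']
  exact ((Equiv.piEquivPiSubtypeProd (· ∈ X) b).symm.sum_comp g).symm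

lemma sum_piSubtypeSplit {ι : Type*} {b : ι → Type*} {p q s : ι → Prop} [DecidablePred q]
    [Fintype (∀ i : {i // p i}, b i)] [Fintype (∀ i : {i // q i}, b i)]
    [Fintype (∀ i : {i // s i}, b i)]
    (h : ∀ i, p i ↔ q i ∨ s i) (hd : ∀ i, q i → ¬ s i) {M : Type*} [AddCommMonoid M]
    (g : (∀ i : {i // p i}, b i) → M) :
    ∑ f, g f = ∑ u, ∑ w, g ((Equiv.piSubtypeSplit b h hd).symm (u, w)) := by
  rw [← Fintype.sum_prod_type' (f := fun u w => g ((Equiv.piSubtypeSplit b h hd).symm (u, w)))]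
  exact ((Equiv.piSubtypeSplit b h hd).symm.sum_comp g).symm

lemma IsForbidden.exists_shareMap_eq {W : QuantumOperation a (∀ i, b i)} {Y : Finset ι}
    (h : IsForbidden W Y) : ∃ β, ∀ ρ, shareMap W Y ρ = ρ.trace • β := by
  obtain ⟨β, -, hβ⟩ := h
  refine ⟨β, fun ρ => ?_⟩
  have := LinearMap.eq_zero_of_densityOperators
    (shareMap W Y - (traceLinearMap a ℂ ℂ).smulRight β) fun ρ hρ => by
      simp [hβ ρ hρ, hρ.2]
  simpa [sub_eq_zero] using LinearMap.congr_fun this ρ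

/-- Tracing out `Y \ Z` from the fixed state on `Y` leaves a fixed state on `Z`. -/
lemma exists_shareMap_eq_of_subset {W : QuantumOperation a (∀ i, b i)} {Y Z : Finset ι}
    (hZ : Z ⊆ Y) (h : ∃ β, ∀ ρ, shareMap W Y ρ = ρ.trace • β) :
    ∃ β, ∀ ρ, shareMap W Z ρ = ρ.trace • β := by
  obtain ⟨β, hβ⟩ := h
  have h₁ : ∀ i, i ∉ Z ↔ i ∈ Y \ Z ∨ i ∉ Y := fun i => by
    have := @hZ i; simp only [Finset.mem_sdiff]; tauto
  have h₂ : ∀ i, i ∈ Y \ Z → ¬ i ∉ Y := fun i => by simp only [Finset.mem_sdiff]; tauto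
  have h₃ : ∀ i, i ∈ Y ↔ i ∈ Z ∨ i ∈ Y \ Z := fun i => by
    have := @hZ i; simp only [Finset.mem_sdiff]; tauto
  have h₄ : ∀ i, i ∈ Z → ¬ i ∈ Y \ Z := fun i => by simp only [Finset.mem_sdiff]; tauto
  let J := fun u w => (Equiv.piSubtypeSplit b h₃ h₄).symm (u, w)
  have hglue : ∀ u w z, glueIndex Z u ((Equiv.piSubtypeSplit b h₁ h₂).symm (w, z)) =
      glueIndex Y (J u w) z := by
    intro u w z
    funext i
    have := @hZ i
    by_cases hi : i ∈ Y <;> by_cases hi' : i ∈ Z <;>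
      simp [hi, hi', glueIndex, Equiv.piSubtypeSplit, J]; tauto
  refine ⟨of fun u v => ∑ w : (∀ i : {i // i ∈ Y \ Z}, b i), β (J u w) (J v w), fun ρ => ?_⟩
  ext u v
  have hβ' : ∀ p q, ∑ z, W.lin ρ (glueIndex Y p z) (glueIndex Y q z) = ρ.trace * β p q :=
    fun p q => congrFun (congrFun (hβ ρ) p) q
  change ∑ z, W.lin ρ (glueIndex Z u z) (glueIndex Z v z) = _
  rw [sum_piSubtypeSplit h₁ h₂]
  simp only [hglue, hβ', Matrix.smul_apply, of_apply, smul_eq_mul, Finset.mul_sum]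

end ShareSplitting

/-! ### The dilated encoder and the theorem. -/

section SecretSharing

open Matrix

variable {ι : Type*} [Fintype ι] [DecidableEq ι]
  {b : ι → Type*} [∀ i, Fintype (b i)] [∀ i, DecidableEq (b i)]
  {a : Type*} [Fintype a] [DecidableEq a]

lemma shareMap_apply_of_kraus {W : QuantumOperation a (∀ i, b i)} {κ : Type*} [Fintype κ]
    {K : κ → Matrix (∀ i, b i) a ℂ} (hK : ∀ ρ, W.lin ρ = ∑ k, K k * ρ * (K k)ᴴ) (X : Finset ι)
    (ρ : Matrix a a ℂ) (u v : ∀ i : {i // i ∈ X}, b i) :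
    shareMap W X ρ u v =
      ∑ w, ∑ k, (K k * ρ * (K k)ᴴ) (glueIndex X u w) (glueIndex X v w) := by
  change ∑ w, W.lin ρ (glueIndex X u w) (glueIndex X v w) = _
  simp only [hK, Matrix.sum_apply]

lemma mul_single_mul_conjTranspose_apply {m : Type*} (K : Matrix m a ℂ) (s t : a) (p q : m) :
    (K * (Matrix.single s t 1 : Matrix a a ℂ) * Kᴴ) p q = K p s * star (K q t) := by
  simp [mul_apply, Matrix.single_apply, ite_and]

lemma vonNeumannEntropy_le_shareMap_of_disjoint {W : QuantumOperation a (∀ i, b i)}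
    {X Y : Finset ι} (hXY : Disjoint X Y) (hY : ∃ β, ∀ ρ, shareMap W Y ρ = ρ.trace • β)
    (hq : IsQualified W (X ∪ Y)) {ρ : Matrix a a ℂ} (hρ : ρ ∈ densityOperators a) :
    vonNeumannEntropy ρ ≤ vonNeumannEntropy (shareMap W X ρ) := by
  obtain ⟨K, hK, hK1⟩ := W.exists_kraus
  obtain ⟨β, hβ⟩ := hY
  have hd : ∀ i, i ∈ X → i ∉ Y := fun _ hi => Finset.disjoint_left.1 hXY hi
  have h₁ : ∀ i, i ∉ X ↔ i ∈ Y ∨ i ∉ X ∪ Y := fun i => by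
    have := hd i; simp only [Finset.mem_union]; tauto
  have h₂ : ∀ i, i ∈ Y → ¬ i ∉ X ∪ Y := fun i => by simp only [Finset.mem_union]; tauto
  have h₃ : ∀ i, i ∉ Y ↔ i ∈ X ∨ i ∉ X ∪ Y := fun i => by
    have := hd i; simp only [Finset.mem_union]; tauto
  have h₄ : ∀ i, i ∈ X → ¬ i ∉ X ∪ Y := fun i => by simp only [Finset.mem_union]; tauto
  have h₅ : ∀ i, i ∈ X ∪ Y ↔ i ∈ X ∨ i ∈ Y := fun i => Finset.mem_union
  let J : (∀ i : {i // i ∈ X}, b i) → (∀ i : {i // i ∈ Y}, b i) →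
      (∀ i : {i // i ∉ X ∪ Y}, b i) → ∀ i, b i :=
    fun x y z => glueIndex X x ((Equiv.piSubtypeSplit b h₁ h₂).symm (y, z))
  have hJY : ∀ x y z, glueIndex Y y ((Equiv.piSubtypeSplit b h₃ h₄).symm (x, z)) = J x y z := by
    intro x y z
    funext i
    have := hd i
    by_cases hi : i ∈ X <;> by_cases hi' : i ∈ Y <;>
      simp [hi, hi', glueIndex, Equiv.piSubtypeSplit, J]; tauto
  have hJXY : ∀ x y z,
      glueIndex (X ∪ Y) ((Equiv.piSubtypeSplit b h₅ hd).symm (x, y)) z = J x y z := by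
    intro x y z
    funext i
    have := hd i
    by_cases hi : i ∈ X <;> by_cases hi' : i ∈ Y <;>
      simp [hi, hi', glueIndex, Equiv.piSubtypeSplit, J]
  -- The Stinespring isometry of the encoder, its environment collecting the Kraus index and the
  -- shares outside `X ∪ Y`.
  let V : Matrix ((∀ i : {i // i ∈ X}, b i) × (∀ i : {i // i ∈ Y}, b i) ×
      ((a × ∀ i, b i) × (∀ i : {i // i ∉ X ∪ Y}, b i))) a ℂ :=
    of fun q s => K q.2.2.1 (J q.1 q.2.1 q.2.2.2) s
  have hV : Vᴴ * V = 1 := by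
    rw [← hK1]
    ext s t
    calc (Vᴴ * V) s t
        = ∑ x, ∑ y, ∑ e, star (V (x, y, e) s) * V (x, y, e) t := by
          simp only [mul_apply, Fintype.sum_prod_type (α₁ := ∀ i : {i // i ∈ X}, b i),
            Fintype.sum_prod_type (α₁ := ∀ i : {i // i ∈ Y}, b i), conjTranspose_apply]
      _ = ∑ x, ∑ y, ∑ z, ∑ l, star (K l (J x y z) s) * K l (J x y z) t := by
          refine Finset.sum_congr rfl fun x _ => Finset.sum_congr rfl fun y _ => ?_
          rw [Fintype.sum_prod_type_right]
          rfl
      _ = ∑ f, ∑ l, star (K l f s) * K l f t := by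
          simp only [sum_glueIndex X (fun f => ∑ l, star (K l f s) * K l f t),
            sum_piSubtypeSplit h₁ h₂]
          rfl
      _ = (∑ l, (K l)ᴴ * K l) s t := by
          rw [Finset.sum_comm, Matrix.sum_apply]
          rfl
  have hX : (of fun x x' => ∑ y, ∑ e, (V * ρ * Vᴴ) (x, y, e) (x', y, e)) = shareMap W X ρ := by
    ext x x'
    rw [shareMap_apply_of_kraus hK, sum_piSubtypeSplit h₁ h₂]
    refine Finset.sum_congr rfl fun y _ => ?_
    rw [Fintype.sum_prod_type_right]
    rfl
  have hy : ∀ y y' s t, ∑ x, ∑ e, V (x, y, e) s * star (V (x, y', e) t) =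
      if s = t then β y y' else 0 := by
    intro y y' s t
    have := congrFun (congrFun (hβ (Matrix.single s t 1)) y) y'
    rw [shareMap_apply_of_kraus hK, sum_piSubtypeSplit h₃ h₄] at this
    simp only [mul_single_mul_conjTranspose_apply, hJY] at this
    have htr : (Matrix.single s t (1 : ℂ)).trace = if s = t then 1 else 0 := by
      split_ifs with h
      · rw [h, trace_single_eq_same]
      · exact trace_single_eq_of_ne _ _ _ h
    rw [htr, Matrix.smul_apply, smul_eq_mul, ite_mul, one_mul, zero_mul] at this
    rw [← this]
    refine Finset.sum_congr rfl fun x _ => ?_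
    rw [Fintype.sum_prod_type_right]
    rfl
  obtain ⟨R, hR⟩ := hq
  obtain ⟨S, hS, hS1⟩ := R.exists_kraus
  have hR' : ∀ τ, R.lin (shareMap W (X ∪ Y) τ) = τ := fun τ => by
    have := LinearMap.eq_zero_of_densityOperators
      (R.lin ∘ₗ shareMap W (X ∪ Y) - LinearMap.id) fun τ hτ => by simp [hR τ hτ]
    simpa [sub_eq_zero] using LinearMap.congr_fun this τ
  -- Kraus operators of `shareMap W (X ∪ Y)`, indexed by the environment of `V`; they satisfy
  -- Knill–Laflamme because `R` inverts that map.
  let T : (a × ∀ i, b i) × (∀ i : {i // i ∉ X ∪ Y}, b i) →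
      Matrix (∀ i : {i // i ∈ X ∪ Y}, b i) a ℂ :=
    fun e => of fun p s => K e.1 (glueIndex (X ∪ Y) p e.2) s
  obtain ⟨γ, hγ⟩ := exists_conjTranspose_mul_eq_smul_one T S hS1 fun τ => by
    rw [← hS]
    convert hR' τ
    ext p q
    rw [shareMap_apply_of_kraus hK, Matrix.sum_apply, Fintype.sum_prod_type_right]
    rfl
  -- The transpose arises because `(T e)ᴴ * T f` conjugates its first factor, whereas here the
  -- second is conjugated.
  have he : ∀ e e' s t, ∑ x, ∑ y, V (x, y, e) s * star (V (x, y, e') t) =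
      if s = t then γᵀ e e' else 0 := by
    intro e e' s t
    have := congrFun (congrFun (hγ e' e) t) s
    simp only [mul_apply, T, conjTranspose_apply, of_apply, sum_piSubtypeSplit h₅ hd, hJXY,
      Matrix.smul_apply, one_apply, smul_eq_mul, mul_ite, mul_one, mul_zero] at this
    rw [transpose_apply]
    simp only [eq_comm (a := s), ← this, V, of_apply]
    refine Finset.sum_congr rfl fun x _ => Finset.sum_congr rfl fun y _ => mul_comm _ _
  rw [← hX]
  exact vonNeumannEntropy_le_of_isometry V hV hy he hρ

end SecretSharing

theorem theorem3 {ι : Type*} [Fintype ι] [DecidableEq ι]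
    {a : Type*} [Fintype a] [DecidableEq a]
    {b : ι → Type*} [∀ i, Fintype (b i)] [∀ i, DecidableEq (b i)]
    (W : QuantumOperation a (∀ i, b i)) (hW : IsQSSScheme W)
    (X : Finset ι) (hX : IsSignificant W X)
    [MeasurableSpace (pureStates a)] [BorelSpace (pureStates a)]
    (μ : Measure (pureStates a)) [IsProbabilityMeasure μ] [μ.IsOpenPosMeasure] :
    vonNeumannEntropy (averageState μ) ≤ vonNeumannEntropy (shareMap W X (averageState μ)) := by
  obtain ⟨Y, hY, hXY⟩ := hX
  -- Removing `X` from `Y` leaves the union unchanged and makes the sets disjoint.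
  exact vonNeumannEntropy_le_shareMap_of_disjoint (Y := Y \ X) Finset.disjoint_sdiff
    (exists_shareMap_eq_of_subset Finset.sdiff_subset hY.exists_shareMap_eq)
    (by rwa [Finset.union_sdiff_self_eq_union]) (averageState_mem_densityOperators μ)
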